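/- **Conventions.** Closed maps are continuous and need not be onto. A perfect map is a closed map with compact point inverses. A continuous map $f:X\to Y$ is quasi-open if $\operatorname{int} f(U)\neq\emptyset$ for every non-empty open $U\subseteq X$. A space is connected if it is not the union of two disjoint non-empty open subsets (so the empty space is connected). Boolean algebras may have $0=1$. A *contact relation* on a Boolean algebra $B$ is a binary relation $C$ on $B$ such that: (C1) $a\neq 0$ implies $aCa$; (C2) $aCb$ implies $a\ne0$ and $b\neq 0$; (C3) $aCb$ implies $bCa$; (C4) $aC(b\vee c)$ iff $aCb$ or $aCc$. Write $a\ll b$ if not $aCb^*$, where $b^*$ denotes the complement of $b$. The pair $(B,C)$ is *connected* if $aCa^*$ for all $a\neq 0,1$. It is a *normal contact algebra* if moreover: (C5) if not $aCb$, then there is $c\in B$ with neither $aCc$ nor $bCc^*$; (C6) if $a\neq1$, then there is $b\neq 0$ with not $bCa$. A *local contact algebra* is a triple $(B,\rho,\mathbb B)$ where $\rho$ is a contact relation on $B$ and $\mathbb B$ is a (possibly non-proper) ideal of $B$ such that: (BC1) if $a\in\mathbb B$, $c\in B$ and $a\ll c$, then $a\ll b\ll c$ for some $b\in\mathbb B$;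 (BC2) if $a\rho b$, then $a\rho(c\wedge b)$ for some $c\in\mathbb B$; (BC3) if $a\neq0$, then there is $b\in\mathbb B\setminus\{0\}$ with $b\ll a$. It is called connected if $(B,\rho)$ is. Either kind of algebra is complete if $B$ is a complete Boolean algebra. For a complete Boolean homomorphism $\varphi:A\to B$ between complete Boolean algebras (a map preserving complements and arbitrary joins and meets), let $\varphi_\Lambda(b)=\bigwedge\{a\in A: b\le\varphi(a)\}$ be its left adjoint. Consider the following categories, with the usual composition of maps. - $\mathbf{SkePerLCCon}$: connected locally compact Hausdorff spaces and quasi-open perfect maps. - $\mathbf{DSkePerLCCon}$: connected complete local contact algebras; morphisms $(A,\rho,\mathbb B)\to(B,\eta,\mathbb B')$ are the complete Boolean homomorphisms $\varphi:A\to B$ such that (L1) $\varphi(a)\,\eta\,\varphi(b)$ implies $a\rho b$ for all $a,b\in A$; (L2) $b\in\mathbb B'$ implies $\varphi_\Lambda(b)\in\mathbb B$; (L3) $a\in\mathbb B$ implies $\varphi(a)\in\mathbb B'$. - $\mathbf{SkeCCon}$: connected compact Hausdorff spaces and quasi-open maps. - $\mathbf{DSkeCCon}$: connected complete normal contact algebras;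 morphisms $(A,C)\to(B,C')$ are the complete Boolean homomorphisms $\varphi:A\to B$ such that $\varphi(a)C'\varphi(b)$ implies $aCb$ for all $a,b\in A$. **Theorem.** The categories $\mathbf{SkePerLCCon}$ and $\mathbf{DSkePerLCCon}$ are dually equivalent (that is, the opposite of the first is equivalent to the second). In particular, the categories $\mathbf{SkeCCon}$ and $\mathbf{DSkeCCon}$ are dually equivalent. -/

import Mathlib

open CategoryTheory

universe u

namespace ContactDuality

/-! ### Maps between topological spaces -/

section Maps

variable {X Y Z : Type*} [TopologicalSpace X] [TopologicalSpace Y] [TopologicalSpace Z]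

/-- A continuous map is quasi-open if the image of every non-empty open set has non-empty
interior. -/
structure IsQuasiOpenMap (f : X → Y) : Prop where
  continuous : Continuous f
  interior_image_nonempty :
    ∀ U : Set X, IsOpen U → U.Nonempty → (interior (f '' U)).Nonempty

/-- A perfect map is a continuous closed map, not necessarily onto, with compact fibres. -/
structure IsPerfectMap (f : X → Y) : Prop where
  continuous : Continuous f
  isClosedMap : IsClosedMap f
  isCompact_fiber : ∀ y : Y, IsCompact (f ⁻¹' {y})

theorem isPerfectMap_iff_isProperMap {f : X → Y} : IsPerfectMap f ↔ IsProperMap f := by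
  rw [isProperMap_iff_isClosedMap_and_compact_fibers]
  exact ⟨fun h => ⟨h.1, h.2, h.3⟩, fun h => ⟨h.1, h.2.1, h.2.2⟩⟩

theorem IsQuasiOpenMap.id : IsQuasiOpenMap (_root_.id : X → X) where
  continuous := continuous_id
  interior_image_nonempty U hU hne := by rwa [Set.image_id, hU.interior_eq]

theorem IsQuasiOpenMap.comp {g : Y → Z} {f : X → Y} (hg : IsQuasiOpenMap g)
    (hf : IsQuasiOpenMap f) : IsQuasiOpenMap (g ∘ f) where
  continuous := hg.continuous.comp hf.continuous
  interior_image_nonempty U hU hne := by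
    refine (hg.interior_image_nonempty _ isOpen_interior
      (hf.interior_image_nonempty U hU hne)).mono (interior_mono ?_)
    rw [Set.image_comp]
    exact Set.image_mono interior_subset

theorem IsPerfectMap.id : IsPerfectMap (_root_.id : X → X) :=
  isPerfectMap_iff_isProperMap.2 isProperMap_id

theorem IsPerfectMap.comp {g : Y → Z} {f : X → Y} (hg : IsPerfectMap g)
    (hf : IsPerfectMap f) : IsPerfectMap (g ∘ f) :=
  isPerfectMap_iff_isProperMap.2
    ((isPerfectMap_iff_isProperMap.1 hg).comp (isPerfectMap_iff_isProperMap.1 hf))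

end Maps

/-! ### Contact algebras -/

section Algebras

variable {B : Type*} [BooleanAlgebra B]

/-- `C` is a contact relation on the Boolean algebra `B`. -/
structure IsContactRel (C : B → B → Prop) : Prop where
  self : ∀ a : B, a ≠ ⊥ → C a a
  ne_bot : ∀ a b : B, C a b → a ≠ ⊥ ∧ b ≠ ⊥
  symm : ∀ a b : B, C a b → C b a
  sup_right : ∀ a b c : B, C a (b ⊔ c) ↔ C a b ∨ C a c

/-- The non-tangential inclusion `a ≪ b` associated with `C`: `a` is not in contact with the
complement of `b`. -/
def NonTang (C : B → B → Prop) (a b : B) : Prop := ¬ C a bᶜ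

/-- The connectedness axiom: every `a ≠ 0, 1` is in contact with its complement. -/
def IsConnectedRel (C : B → B → Prop) : Prop := ∀ a : B, a ≠ ⊥ → a ≠ ⊤ → C a aᶜ

/-- `(B, C)` is a normal contact algebra. -/
structure IsNormalContact (C : B → B → Prop) : Prop extends IsContactRel C where
  normal : ∀ a b : B, ¬ C a b → ∃ c : B, ¬ C a c ∧ ¬ C b cᶜ
  exists_not_rel : ∀ a : B, a ≠ ⊤ → ∃ b : B, b ≠ ⊥ ∧ ¬ C b a

/-- `(B, ρ, I)` is a local contact algebra; the elements of the (possibly non-proper) ideal `I`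
are the bounded elements. -/
structure IsLocalContact (ρ : B → B → Prop) (I : Order.Ideal B) : Prop
    extends IsContactRel ρ where
  interpolate : ∀ a ∈ I, ∀ c : B, NonTang ρ a c → ∃ b ∈ I, NonTang ρ a b ∧ NonTang ρ b c
  rel_bounded : ∀ a b : B, ρ a b → ∃ c ∈ I, ρ a (c ⊓ b)
  exists_bounded : ∀ a : B, a ≠ ⊥ → ∃ b ∈ I, b ≠ ⊥ ∧ NonTang ρ b a

end Algebras

/-! ### The left adjoint of a complete Boolean homomorphism

A `CompleteLatticeHom` preserves arbitrary joins and meets, hence also `0`, `1` and complements;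
between complete Boolean algebras it is the same thing as a complete Boolean homomorphism. -/

section LeftAdjoint

variable {A B D : Type*} [CompleteBooleanAlgebra A] [CompleteBooleanAlgebra B]
  [CompleteBooleanAlgebra D]

/-- The left adjoint of `φ`. -/
def leftAdj (φ : CompleteLatticeHom A B) (b : B) : A := sInf {a : A | b ≤ φ a}

theorem gc_leftAdj (φ : CompleteLatticeHom A B) : GaloisConnection (leftAdj φ) φ := by
  intro b a
  constructor
  · intro h
    have h1 : b ≤ φ (leftAdj φ b) := by
      rw [leftAdj, map_sInf]
      refine le_sInf ?_
      rintro _ ⟨x, hx, rfl⟩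
      exact hx
    exact h1.trans (OrderHomClass.mono φ h)
  · intro h
    exact sInf_le h

theorem leftAdj_id (a : A) : leftAdj (CompleteLatticeHom.id A) a = a :=
  (gc_leftAdj (CompleteLatticeHom.id A)).l_unique GaloisConnection.id (fun _ => rfl)

theorem leftAdj_comp (ψ : CompleteLatticeHom B D) (φ : CompleteLatticeHom A B) (d : D) :
    leftAdj (ψ.comp φ) d = leftAdj φ (leftAdj ψ d) :=
  (gc_leftAdj (ψ.comp φ)).l_unique ((gc_leftAdj ψ).compose (gc_leftAdj φ)) (fun _ => rfl)

end LeftAdjoint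

/-! ### Locally compact Hausdorff spaces and quasi-open perfect maps -/

/-- The category of locally compact Hausdorff spaces and quasi-open perfect maps. -/
structure SkePerLC : Type (u + 1) where
  carrier : Type u
  [top : TopologicalSpace carrier]
  [t2 : T2Space carrier]
  [locallyCompact : LocallyCompactSpace carrier]

attribute [instance] SkePerLC.top SkePerLC.t2 SkePerLC.locallyCompact

namespace SkePerLC

@[ext]
structure Hom (X Y : SkePerLC.{u}) where
  toFun : X.carrier → Y.carrier
  isQuasiOpenMap : IsQuasiOpenMap toFun
  isPerfectMap : IsPerfectMap toFun

instance : Category SkePerLC.{u} where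
  Hom X Y := Hom X Y
  id _ := ⟨id, IsQuasiOpenMap.id, IsPerfectMap.id⟩
  comp f g := ⟨g.toFun ∘ f.toFun, g.isQuasiOpenMap.comp f.isQuasiOpenMap,
    g.isPerfectMap.comp f.isPerfectMap⟩

/-- Connectedness in the sense that there is no partition into two non-empty open sets; the empty
space is connected in this sense, as the one-element contact algebra is connected. -/
def isConnected : ObjectProperty SkePerLC.{u} := fun X => PreconnectedSpace X.carrier

end SkePerLC

/-- The category of connected locally compact Hausdorff spaces and quasi-open perfect maps. -/
abbrev SkePerLCCon : Type (u + 1) := SkePerLC.isConnected.{u}.FullSubcategory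

/-! ### Compact Hausdorff spaces and quasi-open maps -/

/-- The category of compact Hausdorff spaces and quasi-open maps. -/
structure SkeC : Type (u + 1) where
  carrier : Type u
  [top : TopologicalSpace carrier]
  [t2 : T2Space carrier]
  [compact : CompactSpace carrier]

attribute [instance] SkeC.top SkeC.t2 SkeC.compact

namespace SkeC

@[ext]
structure Hom (X Y : SkeC.{u}) where
  toFun : X.carrier → Y.carrier
  isQuasiOpenMap : IsQuasiOpenMap toFun

instance : Category SkeC.{u} where
  Hom X Y := Hom X Y
  id _ := ⟨id, IsQuasiOpenMap.id⟩
  comp f g := ⟨g.toFun ∘ f.toFun, g.isQuasiOpenMap.comp f.isQuasiOpenMap⟩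

def isConnected : ObjectProperty SkeC.{u} := fun X => PreconnectedSpace X.carrier

end SkeC

/-- The category of connected compact Hausdorff spaces and quasi-open maps. -/
abbrev SkeCCon : Type (u + 1) := SkeC.isConnected.{u}.FullSubcategory

/-! ### Complete local contact algebras -/

/-- The category of complete local contact algebras. -/
structure DSkePerLC : Type (u + 1) where
  carrier : Type u
  [alg : CompleteBooleanAlgebra carrier]
  rel : carrier → carrier → Prop
  bounded : Order.Ideal carrier
  isLocalContact : IsLocalContact rel bounded

attribute [instance] DSkePerLC.alg

namespace DSkePerLC

/-- Complete Boolean homomorphisms that reflect contact, preserve boundedness, and whose left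
adjoint preserves boundedness. -/
@[ext]
structure Hom (A B : DSkePerLC.{u}) where
  toHom : CompleteLatticeHom A.carrier B.carrier
  rel_of_map : ∀ a b : A.carrier, B.rel (toHom a) (toHom b) → A.rel a b
  leftAdj_bounded : ∀ b ∈ B.bounded, leftAdj toHom b ∈ A.bounded
  map_bounded : ∀ a ∈ A.bounded, toHom a ∈ B.bounded

instance : Category DSkePerLC.{u} where
  Hom A B := Hom A B
  id A := ⟨CompleteLatticeHom.id A.carrier, fun _ _ h => h,
    fun b hb => by rwa [leftAdj_id], fun _ h => h⟩
  comp f g := ⟨g.toHom.comp f.toHom,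
    fun a b h => f.rel_of_map a b (g.rel_of_map _ _ h),
    fun d hd => by
      rw [leftAdj_comp]
      exact f.leftAdj_bounded _ (g.leftAdj_bounded _ hd),
    fun a ha => g.map_bounded _ (f.map_bounded a ha)⟩

def isConnected : ObjectProperty DSkePerLC.{u} := fun A => IsConnectedRel A.rel

end DSkePerLC

/-- The category of connected complete local contact algebras. -/
abbrev DSkePerLCCon : Type (u + 1) := DSkePerLC.isConnected.{u}.FullSubcategory

/-! ### Complete normal contact algebras -/

/-- The category of complete normal contact algebras. -/
structure DSkeC : Type (u + 1) where
  carrier : Type u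
  [alg : CompleteBooleanAlgebra carrier]
  rel : carrier → carrier → Prop
  isNormalContact : IsNormalContact rel

attribute [instance] DSkeC.alg

namespace DSkeC

/-- Complete Boolean homomorphisms that reflect contact. -/
@[ext]
structure Hom (A B : DSkeC.{u}) where
  toHom : CompleteLatticeHom A.carrier B.carrier
  rel_of_map : ∀ a b : A.carrier, B.rel (toHom a) (toHom b) → A.rel a b

instance : Category DSkeC.{u} where
  Hom A B := Hom A B
  id A := ⟨CompleteLatticeHom.id A.carrier, fun _ _ h => h⟩
  comp f g := ⟨g.toHom.comp f.toHom, fun a b h => f.rel_of_map a b (g.rel_of_map _ _ h)⟩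

def isConnected : ObjectProperty DSkeC.{u} := fun A => IsConnectedRel A.rel

end DSkeC

/-- The category of connected complete normal contact algebras. -/
abbrev DSkeCCon : Type (u + 1) := DSkeC.isConnected.{u}.FullSubcategory

/-- Two categories are dually equivalent if one is equivalent to the opposite of the other. -/
def DuallyEquivalent (C D : Type*) [Category C] [Category D] : Prop := Nonempty (Cᵒᵖ ≌ D)

end ContactDuality

/-! A space is sent to its algebra of regular open sets, with contact meaning that closures meet and
boundedness that the closure is compact; a map `f` is sent to `V ↦ int cl f⁻¹(V)`. Quasi-openness
gives `int f⁻¹(cl s) = int cl f⁻¹(s)` (`IsQuasiOpenMap.interior_preimage_closure`), which makes this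
a complete Boolean homomorphism with left adjoint `U ↦ int cl f(U)`. The functor is shown to be
faithful, full and essentially surjective.

Faithfulness holds because regular open sets separate points. For fullness
(`exists_quasiOpen_perfect_comap_eq`), a morphism `φ` determines `f x` as a point all of whose
regular open neighbourhoods `V` satisfy `x ∈ cl φ(V)`. Such a point exists by (L2) and compactness.
Reflection of contact then gives `f⁻¹(V) ⊆ φ(V)` and `cl φ(V) ⊆ f⁻¹(cl V)`, whence continuity and
`comap = φ`. Quasi-openness comes from the left adjoint, and perfectness from (L3).

For essential surjectivity, the points of an algebra are its round filters containing a bounded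
element (`RoundPoint`). Rounding off ultrafilters supplies enough of them
(`RoundPoint.exists_point`) for `a ↦ {p | a ∈ p}` to be an isomorphism onto the regular open sets.

Connectedness matches on both sides, since a regular open set out of contact with its complement is
clopen. A normal contact algebra is a local one whose ideal is everything, so the compact case
reuses the same lemmas. -/

namespace ContactDuality

/-! ### The complete Boolean algebra of regular open sets -/

/-- Regular open sets: the sets that are the interior of their closure. -/
@[ext]
structure RegularOpen (X : Type*) [TopologicalSpace X] where
  carrier : Set X
  interior_closure' : interior (closure carrier) = carrier

namespace RegularOpen

variable {X : Type*} [TopologicalSpace X]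

instance : SetLike (RegularOpen X) X where
  coe := carrier
  coe_injective _ _ h := RegularOpen.ext h

theorem interior_closure (U : RegularOpen X) : interior (closure (U : Set X)) = U :=
  U.interior_closure'

theorem isOpen (U : RegularOpen X) : IsOpen (U : Set X) := by
  rw [← U.interior_closure]
  exact isOpen_interior

/-- The smallest regular open set containing a given open set. -/
def regularize (s : Set X) : RegularOpen X := ⟨interior (closure s), interior_closure_idem⟩

@[simp] theorem coe_regularize (s : Set X) :
    (regularize s : Set X) = interior (closure s) := rfl

theorem _root_.IsOpen.subset_regularize {s : Set X} (hs : IsOpen s) :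
    s ⊆ (regularize s : Set X) := hs.subset_interior_closure

theorem regularize_subset {s : Set X} {U : RegularOpen X} (h : s ⊆ U) :
    (regularize s : Set X) ⊆ U := by
  rw [coe_regularize, ← U.interior_closure]
  exact interior_mono (closure_mono h)

theorem closure_regularize {s : Set X} (hs : IsOpen s) :
    closure (regularize s : Set X) = closure s :=
  subset_antisymm (closure_minimal interior_subset isClosed_closure)
    (closure_mono hs.subset_regularize)

/-- Regularization respects finite intersections of open sets; the distributive law of the algebra
rests on this. -/
theorem interior_closure_inter_subset {s t : Set X} (hs : IsOpen s) :
    interior (closure s) ∩ interior (closure t) ⊆ interior (closure (s ∩ t)) := by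
  refine interior_maximal ?_ (isOpen_interior.inter isOpen_interior)
  rintro x ⟨hxs, hxt⟩
  have h : x ∈ closure (interior (closure t) ∩ s) :=
    isOpen_interior.inter_closure ⟨hxt, interior_subset hxs⟩
  refine closure_minimal ?_ isClosed_closure h
  rintro y ⟨hyt, hys⟩
  exact hs.inter_closure ⟨hys, interior_subset hyt⟩

instance : PartialOrder (RegularOpen X) := .ofSetLike (RegularOpen X) X

instance : Max (RegularOpen X) := ⟨fun U V => regularize (U ∪ V)⟩

instance : Min (RegularOpen X) := ⟨fun U V => ⟨U ∩ V,
  subset_antisymm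
    (Set.subset_inter ((regularize_subset (U := U) Set.inter_subset_left))
      (regularize_subset (U := V) Set.inter_subset_right))
    (U.isOpen.inter V.isOpen).subset_interior_closure⟩⟩

instance : Top (RegularOpen X) := ⟨⟨Set.univ, by simp⟩⟩

instance : Bot (RegularOpen X) := ⟨⟨∅, by simp⟩⟩

instance : SupSet (RegularOpen X) := ⟨fun S => regularize (⋃ U ∈ S, (U : Set X))⟩

instance : InfSet (RegularOpen X) := ⟨fun S => ⟨interior (⋂ U ∈ S, (U : Set X)),
  subset_antisymm
    (interior_maximal
      (Set.subset_iInter₂ fun U hU => regularize_subset (U := U)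
        (interior_subset.trans (Set.biInter_subset_of_mem hU)))
      isOpen_interior)
    isOpen_interior.subset_interior_closure⟩⟩

instance : Compl (RegularOpen X) := ⟨fun U => ⟨(closure (U : Set X))ᶜ, by
  rw [closure_compl, U.interior_closure, interior_compl]⟩⟩

@[simp] theorem coe_sup (U V : RegularOpen X) :
    ((U ⊔ V : RegularOpen X) : Set X) = interior (closure (U ∪ V)) := rfl

@[simp] theorem coe_inf (U V : RegularOpen X) :
    ((U ⊓ V : RegularOpen X) : Set X) = (U : Set X) ∩ V := rfl

@[simp] theorem coe_top : ((⊤ : RegularOpen X) : Set X) = Set.univ := rfl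

@[simp] theorem coe_bot : ((⊥ : RegularOpen X) : Set X) = ∅ := rfl

@[simp] theorem coe_compl (U : RegularOpen X) :
    ((Uᶜ : RegularOpen X) : Set X) = (closure U)ᶜ := rfl

theorem le_iff {U V : RegularOpen X} : U ≤ V ↔ (U : Set X) ⊆ V := Iff.rfl

instance : CompleteBooleanAlgebra (RegularOpen X) where
  sup := (· ⊔ ·)
  inf := (· ⊓ ·)
  le_sup_left U V := show (U : Set X) ⊆ interior (closure (U ∪ V)) from
    Set.subset_union_left.trans (U.isOpen.union V.isOpen).subset_interior_closure
  le_sup_right U V := show (V : Set X) ⊆ interior (closure (U ∪ V)) from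
    Set.subset_union_right.trans (U.isOpen.union V.isOpen).subset_interior_closure
  sup_le _ _ _ hU hV := regularize_subset (Set.union_subset hU hV)
  inf_le_left _ _ := Set.inter_subset_left
  inf_le_right _ _ := Set.inter_subset_right
  le_inf _ _ _ hU hV := Set.subset_inter hU hV
  isLUB_sSup S := by
    refine ⟨fun U hU => ?_, fun V hV => regularize_subset (Set.iUnion₂_subset hV)⟩
    exact (Set.subset_biUnion_of_mem (u := fun U : RegularOpen X => (U : Set X)) hU).trans
      (isOpen_biUnion fun U _ => U.isOpen).subset_regularize
  isGLB_sInf S := by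
    refine ⟨fun U hU => interior_subset.trans (Set.biInter_subset_of_mem hU), fun V hV => ?_⟩
    exact interior_maximal (Set.subset_iInter₂ hV) V.isOpen
  le_sup_inf U V W := by
    refine (interior_closure_inter_subset (U.isOpen.union V.isOpen)).trans ?_
    rw [← Set.union_inter_distrib_left]
    rfl
  inf_compl_le_bot U := fun x (hx : x ∈ (U : Set X) ∩ (closure (U : Set X))ᶜ) =>
    hx.2 (subset_closure hx.1)
  top_le_sup_compl U x _ := by
    have h : closure ((U : Set X) ∪ (closure (U : Set X))ᶜ) = Set.univ := by
      rw [closure_union, closure_compl, U.interior_closure, Set.eq_univ_iff_forall]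
      intro y
      by_cases hy : y ∈ (U : Set X)
      · exact Or.inl (subset_closure hy)
      · exact Or.inr hy
    change x ∈ interior (closure ((U : Set X) ∪ (closure (U : Set X))ᶜ))
    rw [h, interior_univ]
    trivial
  le_top _ _ _ := trivial
  bot_le _ _ := False.elim

theorem closure_sup (U V : RegularOpen X) :
    closure ((U ⊔ V : RegularOpen X) : Set X) = closure U ∪ closure V := by
  rw [coe_sup, ← coe_regularize, closure_regularize (U.isOpen.union V.isOpen), closure_union]

theorem closure_compl (U : RegularOpen X) :
    closure ((Uᶜ : RegularOpen X) : Set X) = (U : Set X)ᶜ := by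
  rw [coe_compl, _root_.closure_compl, U.interior_closure]

theorem ne_bot_iff {U : RegularOpen X} : U ≠ ⊥ ↔ (U : Set X).Nonempty := by
  rw [Set.nonempty_iff_ne_empty, ← coe_bot, Ne, Ne, SetLike.coe_set_eq]

/-- In a regular space, every neighbourhood of a point contains the closure of a regular open
neighbourhood. -/
theorem exists_closure_subset [RegularSpace X] {x : X} {s : Set X} (hs : s ∈ nhds x) :
    ∃ U : RegularOpen X, x ∈ U ∧ closure (U : Set X) ⊆ s := by
  obtain ⟨t, ht, htc, hts⟩ := exists_mem_nhds_isClosed_subset hs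
  have hc : closure (regularize (interior t) : Set X) ⊆ t := by
    rw [closure_regularize isOpen_interior]
    exact closure_minimal interior_subset htc
  exact ⟨regularize (interior t),
    isOpen_interior.subset_regularize (mem_interior_iff_mem_nhds.2 ht), hc.trans hts⟩

/-- In a locally compact Hausdorff space, between a compact set and a neighbourhood there is a
regular open set with compact closure. -/
theorem exists_isCompact_closure [T2Space X] [LocallyCompactSpace X] {K s : Set X}
    (hK : IsCompact K) (hs : IsOpen s) (hKs : K ⊆ s) :
    ∃ U : RegularOpen X, K ⊆ U ∧ closure (U : Set X) ⊆ s ∧ IsCompact (closure (U : Set X)) := by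
  obtain ⟨L, hL, hKL, hLs⟩ := exists_compact_between hK hs hKs
  have hc : closure (regularize (interior L) : Set X) ⊆ L := by
    rw [closure_regularize isOpen_interior]
    exact closure_minimal interior_subset hL.isClosed
  exact ⟨regularize (interior L), hKL.trans isOpen_interior.subset_regularize, hc.trans hLs,
    hL.of_isClosed_subset isClosed_closure hc⟩

/-! ### The local contact algebra of regular open sets -/

/-- Two regular open sets are in contact if their closures meet. -/
def Contact (U V : RegularOpen X) : Prop := (closure (U : Set X) ∩ closure V).Nonempty

theorem nonTang_contact_iff {U V : RegularOpen X} :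
    NonTang Contact U V ↔ closure (U : Set X) ⊆ V := by
  rw [NonTang, Contact, closure_compl, ← Set.not_disjoint_iff_nonempty_inter, not_not,
    Set.disjoint_compl_right_iff_subset]

theorem isContactRel_contact : IsContactRel (Contact (X := X)) where
  self U hU := by
    obtain ⟨x, hx⟩ := ne_bot_iff.1 hU
    exact ⟨x, subset_closure hx, subset_closure hx⟩
  ne_bot U V := by
    rintro ⟨x, hxU, hxV⟩
    exact ⟨ne_bot_iff.2 (closure_nonempty_iff.1 ⟨x, hxU⟩),
      ne_bot_iff.2 (closure_nonempty_iff.1 ⟨x, hxV⟩)⟩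
  symm U V h := by rwa [Contact, Set.inter_comm]
  sup_right U V W := by
    rw [Contact, closure_sup, Set.inter_union_distrib_left, Set.union_nonempty]
    rfl

variable (X) in
/-- The ideal of regular open sets with compact closure. -/
def compactClosure : Order.Ideal (RegularOpen X) where
  carrier := {U | IsCompact (closure (U : Set X))}
  lower' U V hVU hU := IsCompact.of_isClosed_subset hU isClosed_closure (closure_mono hVU)
  nonempty' := ⟨⊥, by simp⟩
  directed' U hU V hV := ⟨U ⊔ V, by
    change IsCompact _
    rw [closure_sup]
    exact IsCompact.union hU hV, le_sup_left, le_sup_right⟩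

theorem mem_compactClosure {U : RegularOpen X} :
    U ∈ compactClosure X ↔ IsCompact (closure (U : Set X)) := Iff.rfl

theorem isLocalContact_contact [T2Space X] [LocallyCompactSpace X] :
    IsLocalContact (Contact (X := X)) (compactClosure X) where
  toIsContactRel := isContactRel_contact
  interpolate U hU V h := by
    obtain ⟨W, hUW, hWV, hW⟩ := exists_isCompact_closure hU V.isOpen (nonTang_contact_iff.1 h)
    exact ⟨W, hW, nonTang_contact_iff.2 hUW, nonTang_contact_iff.2 hWV⟩
  rel_bounded U V := by
    rintro ⟨x, hxU, hxV⟩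
    obtain ⟨W, hxW, -, hW⟩ := exists_isCompact_closure (isCompact_singleton (x := x))
      isOpen_univ (Set.subset_univ _)
    exact ⟨W, hW, x, hxU, W.isOpen.inter_closure ⟨hxW rfl, hxV⟩⟩
  exists_bounded U hU := by
    obtain ⟨x, hx⟩ := ne_bot_iff.1 hU
    obtain ⟨W, hxW, hWU, hW⟩ := exists_isCompact_closure (isCompact_singleton (x := x))
      U.isOpen (Set.singleton_subset_iff.2 hx)
    exact ⟨W, hW, ne_bot_iff.2 ⟨x, hxW rfl⟩, nonTang_contact_iff.2 hWU⟩

/-- Being out of contact with the complement means `cl U ⊆ U`, so the sets violating the axiom are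
exactly the nontrivial clopen sets, and every clopen set is regular open. -/
theorem isConnectedRel_contact_iff :
    IsConnectedRel (Contact (X := X)) ↔ PreconnectedSpace X := by
  have key : ∀ U : RegularOpen X, Contact U Uᶜ ↔ ¬ IsClosed (U : Set X) := fun U => by
    rw [← closure_subset_iff_isClosed, ← nonTang_contact_iff, NonTang, not_not]
  rw [preconnectedSpace_iff_clopen]
  constructor
  · intro h s hs
    by_contra! hne
    let U : RegularOpen X := ⟨s, by rw [hs.isClosed.closure_eq, hs.isOpen.interior_eq]⟩
    refine (key U).1 (h U (fun hU => hne.1.ne_empty ?_) (fun hU => hne.2 ?_)) hs.isClosed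
    · exact congrArg (fun V : RegularOpen X => (V : Set X)) hU
    · exact congrArg (fun V : RegularOpen X => (V : Set X)) hU
  · intro h U hU hU'
    refine (key U).2 fun hc => ?_
    rcases h U ⟨hc, U.isOpen⟩ with h | h
    · exact hU (SetLike.coe_injective h)
    · exact hU' (SetLike.coe_injective h)

end RegularOpen

/-! ### The homomorphism of regular open algebras induced by a quasi-open map -/

section QuasiOpen

variable {X Y Z : Type*} [TopologicalSpace X] [TopologicalSpace Y] [TopologicalSpace Z]
  {f : X → Y}

open RegularOpen

/-- Applying the definition to `s ∩ f⁻¹(N)`, for each open `N` around an image point, localizes it.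
-/
theorem IsQuasiOpenMap.image_subset_closure_interior (hf : IsQuasiOpenMap f) {s : Set X}
    (hs : IsOpen s) : f '' s ⊆ closure (interior (f '' s)) := by
  rintro _ ⟨x, hx, rfl⟩
  rw [mem_closure_iff]
  intro N hN hxN
  obtain ⟨y, hy⟩ := hf.interior_image_nonempty (s ∩ f ⁻¹' N) (hs.inter (hN.preimage hf.continuous))
    ⟨x, hx, hxN⟩
  refine ⟨y, ?_, interior_mono (Set.image_mono Set.inter_subset_left) hy⟩
  obtain ⟨z, hz, rfl⟩ := interior_subset hy
  exact hz.2

/-- An open set inside `f⁻¹(cl s)` has an image whose interior is non-empty and lies in `cl s`,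
hence meets `s`. -/
theorem IsQuasiOpenMap.interior_preimage_closure (hf : IsQuasiOpenMap f) (s : Set Y) :
    interior (f ⁻¹' closure s) = interior (closure (f ⁻¹' s)) := by
  refine subset_antisymm (interior_maximal ?_ isOpen_interior) (interior_mono ?_)
  · intro x hx
    rw [mem_closure_iff]
    intro N hN hxN
    obtain ⟨y, hy⟩ := hf.interior_image_nonempty _ (hN.inter isOpen_interior) ⟨x, hxN, hx⟩
    have hys : y ∈ closure s := by
      obtain ⟨z, hz, rfl⟩ := interior_subset hy
      exact interior_subset (s := f ⁻¹' closure s) hz.2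
    obtain ⟨w, hw, hws⟩ := mem_closure_iff.1 hys _ isOpen_interior hy
    obtain ⟨z, hz, rfl⟩ := interior_subset hw
    exact ⟨z, hz.1, hws⟩
  · exact closure_minimal (Set.preimage_mono subset_closure)
      (isClosed_closure.preimage hf.continuous)

/-- The regularization of the image, left adjoint to `IsQuasiOpenMap.comap`. -/
theorem IsQuasiOpenMap.gc_image_preimage (hf : IsQuasiOpenMap f) :
    GaloisConnection (fun U : RegularOpen X => regularize (f '' U))
      (fun V : RegularOpen Y => regularize (f ⁻¹' V)) := by
  intro U V
  -- Only this equivalence needs images to lie in the closure of their interior; the rest moves `f`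
  -- across the inclusion.
  have h1 : regularize (f '' U) ≤ V ↔ f '' U ⊆ closure V := by
    constructor
    · intro h
      refine (hf.image_subset_closure_interior U.isOpen).trans (closure_mono ?_)
      exact (interior_mono subset_closure).trans h
    · intro h
      rw [le_iff, coe_regularize, ← V.interior_closure]
      exact interior_mono (closure_minimal h isClosed_closure)
  rw [h1, Set.image_subset_iff, le_iff, coe_regularize, ← hf.interior_preimage_closure,
    U.isOpen.subset_interior_iff]

theorem IsQuasiOpenMap.regularize_preimage_compl (hf : IsQuasiOpenMap f) (V : RegularOpen Y) :
    regularize (f ⁻¹' (Vᶜ : RegularOpen Y)) = (regularize (f ⁻¹' V))ᶜ := by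
  refine SetLike.coe_injective ?_
  rw [coe_compl (regularize _), closure_regularize (V.isOpen.preimage hf.continuous), coe_regularize,
    ← hf.interior_preimage_closure, RegularOpen.closure_compl, Set.preimage_compl,
    interior_compl]

/-- The complete Boolean homomorphism `V ↦ int (cl (f⁻¹ V))` induced by a quasi-open map. -/
def IsQuasiOpenMap.comap (hf : IsQuasiOpenMap f) :
    CompleteLatticeHom (RegularOpen Y) (RegularOpen X) where
  toFun V := regularize (f ⁻¹' V)
  map_sInf' S := by
    rw [hf.gc_image_preimage.u_sInf, sInf_image]
  -- A right adjoint preserves meets; joins follow by taking complements.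
  map_sSup' S := by
    rw [← compl_inj_iff, ← hf.regularize_preimage_compl, compl_sSup, hf.gc_image_preimage.u_iInf₂,
      compl_sSup, iInf_image]
    simp only [hf.regularize_preimage_compl]

theorem IsQuasiOpenMap.coe_comap (hf : IsQuasiOpenMap f) (V : RegularOpen Y) :
    (hf.comap V : Set X) = interior (closure (f ⁻¹' V)) := rfl

theorem IsQuasiOpenMap.preimage_subset_comap (hf : IsQuasiOpenMap f) (V : RegularOpen Y) :
    f ⁻¹' V ⊆ (hf.comap V : Set X) :=
  (V.isOpen.preimage hf.continuous).subset_interior_closure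

theorem IsQuasiOpenMap.closure_comap_subset (hf : IsQuasiOpenMap f) (V : RegularOpen Y) :
    closure (hf.comap V : Set X) ⊆ f ⁻¹' closure V := by
  refine closure_minimal (interior_subset.trans ?_) (isClosed_closure.preimage hf.continuous)
  exact closure_minimal (Set.preimage_mono subset_closure)
    (isClosed_closure.preimage hf.continuous)

theorem IsQuasiOpenMap.leftAdj_comap (hf : IsQuasiOpenMap f) (U : RegularOpen X) :
    leftAdj hf.comap U = regularize (f '' U) :=
  (gc_leftAdj hf.comap).l_unique hf.gc_image_preimage fun _ => rfl

theorem IsQuasiOpenMap.comap_id : (IsQuasiOpenMap.id (X := X)).comap = CompleteLatticeHom.id _ := by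
  ext U : 1
  exact SetLike.coe_injective U.interior_closure

theorem IsQuasiOpenMap.comap_comp {g : Y → Z} (hg : IsQuasiOpenMap g) (hf : IsQuasiOpenMap f) :
    (hg.comp hf).comap = hf.comap.comp hg.comap := by
  ext U : 1
  refine SetLike.coe_injective ?_
  have h : IsOpen (g ⁻¹' U) := U.isOpen.preimage hg.continuous
  -- The inner regularization is harmless: it does not change the closure of `g⁻¹(U)`, and only that
  -- closure enters.
  rw [CompleteLatticeHom.comp_apply, coe_comap, coe_comap,
    ← hf.interior_preimage_closure, Set.preimage_comp,
    ← hf.interior_preimage_closure, ← closure_regularize h]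
  rfl

theorem IsQuasiOpenMap.contact_of_comap (hf : IsQuasiOpenMap f) {U V : RegularOpen Y}
    (h : Contact (hf.comap U) (hf.comap V)) : Contact U V := by
  obtain ⟨x, hU, hV⟩ := h
  exact ⟨f x, hf.closure_comap_subset U hU, hf.closure_comap_subset V hV⟩

theorem IsQuasiOpenMap.leftAdj_mem_compactClosure [T2Space Y] (hf : IsQuasiOpenMap f)
    {U : RegularOpen X} (hU : U ∈ compactClosure X) :
    leftAdj hf.comap U ∈ compactClosure Y := by
  have hK : IsCompact (f '' closure U) := IsCompact.image hU hf.continuous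
  rw [mem_compactClosure, hf.leftAdj_comap]
  refine hK.of_isClosed_subset isClosed_closure (closure_minimal ?_ hK.isClosed)
  exact interior_subset.trans (closure_minimal (Set.image_mono subset_closure) hK.isClosed)

theorem IsQuasiOpenMap.comap_mem_compactClosure (hf : IsQuasiOpenMap f) (hp : IsPerfectMap f)
    {V : RegularOpen Y} (hV : V ∈ compactClosure Y) : hf.comap V ∈ compactClosure X :=
  ((isPerfectMap_iff_isProperMap.1 hp).isCompact_preimage hV).of_isClosed_subset isClosed_closure
    (hf.closure_comap_subset V)

theorem IsQuasiOpenMap.eq_of_comap_eq [T2Space Y] [RegularSpace Y] {g : X → Y}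
    (hf : IsQuasiOpenMap f) (hg : IsQuasiOpenMap g) (h : hf.comap = hg.comap) : f = g := by
  funext x
  by_contra hne
  obtain ⟨U, hxU, hU⟩ := exists_closure_subset (isOpen_compl_singleton.mem_nhds hne)
  have hx : x ∈ (hg.comap U : Set X) := h ▸ hf.preimage_subset_comap U hxU
  exact hU (hg.closure_comap_subset U (subset_closure hx)) rfl

end QuasiOpen

/-! ### Every morphism of regular open algebras is induced by a quasi-open perfect map -/

section Realization

variable {X Y : Type*} [TopologicalSpace X] [T2Space X] [LocallyCompactSpace X]
  [TopologicalSpace Y]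

open RegularOpen

/-- If every `y` had a neighbourhood `V y` with `x ∉ cl φ(V y)`, finitely many would cover the
closure of `leftAdj φ U`, compact by (L2), for some `U ∋ x`. By adjunction `U` lies below the join
of the `φ(V y)`, so `x` is in one of their closures. -/
theorem exists_forall_mem_closure_map
    (φ : CompleteLatticeHom (RegularOpen Y) (RegularOpen X))
    (hl : ∀ U ∈ compactClosure X, leftAdj φ U ∈ compactClosure Y) (x : X) :
    ∃ y : Y, ∀ V : RegularOpen Y, y ∈ V → x ∈ closure (φ V : Set X) := by
  obtain ⟨U, hxU, -, hU⟩ := exists_isCompact_closure (isCompact_singleton (x := x))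
    isOpen_univ (Set.subset_univ _)
  by_contra! H
  choose V hyV hxV using H
  obtain ⟨t, ht⟩ := (hl U hU).elim_finite_subcover (fun y => (V y : Set Y))
    (fun y => (V y).isOpen) fun y _ => Set.mem_iUnion.2 ⟨y, hyV y⟩
  have hle : leftAdj φ U ≤ t.sup V := by
    intro y hy
    obtain ⟨z, hz, hyz⟩ := Set.mem_iUnion₂.1 (ht (subset_closure hy))
    exact Finset.le_sup (f := V) hz hyz
  have hUle : U ≤ t.sup fun y => φ (V y) := by
    have := (gc_leftAdj φ _ _).1 hle
    rwa [map_finset_sup] at this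
  have hcl : ∀ s : Finset Y, x ∉ closure ((s.sup fun y => φ (V y) : RegularOpen X) : Set X) := by
    intro s
    induction s using Finset.cons_induction with
    | empty => simp
    | cons a s ha ih =>
      rw [Finset.sup_cons, closure_sup]
      exact fun h => h.elim (hxV a) ih
  exact hcl t (subset_closure (hUle (hxU rfl)))

theorem exists_quasiOpen_perfect_comap_eq [T2Space Y] [LocallyCompactSpace Y]
    (φ : CompleteLatticeHom (RegularOpen Y) (RegularOpen X))
    (hc : ∀ U V, Contact (φ U) (φ V) → Contact U V)
    (hl : ∀ U ∈ compactClosure X, leftAdj φ U ∈ compactClosure Y)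
    (hb : ∀ V ∈ compactClosure Y, φ V ∈ compactClosure X) :
    ∃ (f : X → Y) (hf : IsQuasiOpenMap f), IsPerfectMap f ∧ hf.comap = φ := by
  choose f hf using exists_forall_mem_closure_map φ hl
  -- Reflection of contact turns `W ≪ V` into `φ W ≪ φ V`, and `x ∈ cl φ(W)` by the choice of `f`.
  have hsub : ∀ V : RegularOpen Y, f ⁻¹' V ⊆ (φ V : Set X) := by
    intro V x hx
    obtain ⟨W, hxW, hWV⟩ := exists_closure_subset (V.isOpen.mem_nhds hx)
    have h : NonTang Contact (φ W) (φ V) := fun h => nonTang_contact_iff.2 hWV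
      (hc _ _ (by rwa [map_compl']))
    exact nonTang_contact_iff.1 h (hf x W hxW)
  have hcl : ∀ V : RegularOpen Y, closure (φ V : Set X) ⊆ f ⁻¹' closure V := by
    intro V x hx
    by_contra h
    have := hsub Vᶜ (a := x) h
    rw [map_compl'] at this
    exact this hx
  have hcont : Continuous f := by
    rw [continuous_iff_continuousAt]
    intro x s hs
    obtain ⟨V, hxV, hV⟩ := exists_closure_subset hs
    refine Filter.mem_map.2 (Filter.mem_of_superset ((φ V).isOpen.mem_nhds (hsub V hxV)) ?_)
    exact (subset_closure.trans (hcl V)).trans (Set.preimage_mono hV)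
  have hq : IsQuasiOpenMap f := by
    refine ⟨hcont, fun s hs ⟨x, hx⟩ => ?_⟩
    obtain ⟨U, hxU, hUs, hU⟩ := exists_isCompact_closure (isCompact_singleton (x := x))
      hs (Set.singleton_subset_iff.2 hx)
    have hK : IsClosed (f '' closure U) := (hU.image hcont).isClosed
    -- A point `y` outside `f(cl U)` has a neighbourhood `V` with closure disjoint from it, so `U ≤
    -- φ Vᶜ`, and `leftAdj φ U ≤ Vᶜ` misses `y`.
    have hle : ((leftAdj φ U : RegularOpen Y) : Set Y) ⊆ f '' closure U := by
      intro y hy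
      by_contra hyK
      obtain ⟨V, hyV, hV⟩ := exists_closure_subset (hK.isOpen_compl.mem_nhds hyK)
      have h : U ≤ φ Vᶜ := by
        intro z hz
        refine hsub Vᶜ fun hzV => ?_
        exact hV hzV ⟨z, subset_closure hz, rfl⟩
      exact (gc_leftAdj φ _ _).2 h hy (subset_closure hyV)
    obtain ⟨y, hy⟩ : ((leftAdj φ U : RegularOpen Y) : Set Y).Nonempty := by
      rw [← ne_bot_iff]
      intro h
      have := (gc_leftAdj φ U ⊥).1 h.le
      rw [map_bot] at this
      exact this (hxU rfl)
    exact ⟨y, interior_maximal (hle.trans (Set.image_mono hUs)) (leftAdj φ U).isOpen hy⟩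
  have hp : IsPerfectMap f := by
    rw [isPerfectMap_iff_isProperMap, isProperMap_iff_isCompact_preimage]
    refine ⟨hcont, fun K hK => ?_⟩
    obtain ⟨V, hKV, -, hV⟩ := exists_isCompact_closure hK isOpen_univ (Set.subset_univ _)
    exact IsCompact.of_isClosed_subset (hb V hV) (hK.isClosed.preimage hcont)
      ((Set.preimage_mono hKV).trans ((hsub V).trans subset_closure))
  have hle : ∀ V, hq.comap V ≤ φ V := fun V => regularize_subset (hsub V)
  refine ⟨f, hq, hp, ?_⟩
  ext V : 1
  refine le_antisymm (hle V) ?_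
  -- Both sides preserve complements, so one inequality for all `V` forces equality.
  have := hle Vᶜ
  rwa [map_compl', map_compl', compl_le_compl_iff_le] at this

end Realization

/-! ### Elementary properties of contact relations -/

section ContactRel

variable {B : Type*} [BooleanAlgebra B] {ρ : B → B → Prop} {a a' b b' : B}

namespace IsContactRel

theorem mono (h : IsContactRel ρ) (ha : a ≤ a') (hb : b ≤ b') (hab : ρ a b) : ρ a' b' := by
  have h1 : ρ a b' := by
    rw [← sup_eq_right.2 hb, h.sup_right]
    exact Or.inl hab
  refine h.symm _ _ ?_
  rw [← sup_eq_right.2 ha, h.sup_right]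
  exact Or.inl (h.symm _ _ h1)

theorem rel_of_inf_ne_bot (h : IsContactRel ρ) (hab : a ⊓ b ≠ ⊥) : ρ a b :=
  h.mono inf_le_left inf_le_right (h.self _ hab)

theorem nonTang_mono (h : IsContactRel ρ) (ha : a' ≤ a) (hb : b ≤ b') (hab : NonTang ρ a b) :
    NonTang ρ a' b' :=
  fun h' => hab (h.mono ha (compl_le_compl hb) h')

theorem le_of_nonTang (h : IsContactRel ρ) (hab : NonTang ρ a b) : a ≤ b := by
  rw [← disjoint_compl_right_iff, disjoint_iff]
  by_contra hne
  exact hab (h.rel_of_inf_ne_bot hne)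

theorem nonTang_inf_right (h : IsContactRel ρ) (hab : NonTang ρ a b) (hab' : NonTang ρ a b') :
    NonTang ρ a (b ⊓ b') := by
  rw [NonTang, compl_inf, h.sup_right]
  exact fun h' => h'.elim hab hab'

theorem nonTang_inf (h : IsContactRel ρ) (hab : NonTang ρ a b) (hab' : NonTang ρ a' b') :
    NonTang ρ (a ⊓ a') (b ⊓ b') :=
  h.nonTang_inf_right (h.nonTang_mono inf_le_left le_rfl hab)
    (h.nonTang_mono inf_le_right le_rfl hab')

theorem nonTang_compl (h : IsContactRel ρ) (hab : NonTang ρ a b) : NonTang ρ bᶜ aᶜ := by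
  rw [NonTang, compl_compl]
  exact fun h' => hab (h.symm _ _ h')

theorem nonTang_top (h : IsContactRel ρ) (a : B) : NonTang ρ a ⊤ := by
  rw [NonTang, compl_top]
  exact fun h' => (h.ne_bot _ _ h').2 rfl

end IsContactRel

end ContactRel

/-! ### The space of bounded maximal round filters -/

/-- A point of a local contact algebra: a proper round filter that contains a bounded element and
decides between `aᶜ` and `b` whenever `a ≪ b`. -/
@[ext]
structure RoundPoint {B : Type*} [BooleanAlgebra B] (ρ : B → B → Prop) (I : Order.Ideal B) where
  carrier : Set B
  bot_notMem' : ⊥ ∉ carrier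
  mem_of_le' : ∀ a b, a ≤ b → a ∈ carrier → b ∈ carrier
  inf_mem' : ∀ a ∈ carrier, ∀ b ∈ carrier, a ⊓ b ∈ carrier
  round' : ∀ a ∈ carrier, ∃ b ∈ carrier, NonTang ρ b a
  compl_mem_or_mem' : ∀ a b, NonTang ρ a b → aᶜ ∈ carrier ∨ b ∈ carrier
  exists_bounded' : ∃ a ∈ I, a ∈ carrier

namespace RoundPoint

section BooleanAlgebra

variable {B : Type*} [BooleanAlgebra B] {ρ : B → B → Prop} {I : Order.Ideal B}

instance : SetLike (RoundPoint ρ I) B where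
  coe := carrier
  coe_injective _ _ h := RoundPoint.ext h

variable {p q : RoundPoint ρ I} {a b : B}

theorem bot_notMem (p : RoundPoint ρ I) : ⊥ ∉ p := p.bot_notMem'

theorem mem_of_le (hab : a ≤ b) (ha : a ∈ p) : b ∈ p := p.mem_of_le' a b hab ha

theorem inf_mem_iff : a ⊓ b ∈ p ↔ a ∈ p ∧ b ∈ p :=
  ⟨fun h => ⟨mem_of_le inf_le_left h, mem_of_le inf_le_right h⟩,
    fun h => p.inf_mem' a h.1 b h.2⟩

theorem exists_nonTang (ha : a ∈ p) : ∃ b ∈ p, NonTang ρ b a := p.round' a ha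

theorem compl_mem_or_mem (p : RoundPoint ρ I) (hab : NonTang ρ a b) : aᶜ ∈ p ∨ b ∈ p :=
  p.compl_mem_or_mem' a b hab

theorem exists_bounded (p : RoundPoint ρ I) : ∃ a ∈ I, a ∈ p := p.exists_bounded'

theorem top_mem (p : RoundPoint ρ I) : ⊤ ∈ p :=
  let ⟨_, _, ha⟩ := p.exists_bounded
  mem_of_le le_top ha

theorem compl_notMem (ha : a ∈ p) : aᶜ ∉ p := fun h =>
  p.bot_notMem (by simpa using inf_mem_iff.2 ⟨ha, h⟩)

/-- The point determined by an ultrafilter, presented as the complement of a prime ideal, that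
contains a bounded element. -/
def ofPrime (h : IsLocalContact ρ I) (J : Order.Ideal B) (hJ : J.IsPrime) (d : B) (hdI : d ∈ I)
    (hdJ : d ∉ J) : RoundPoint ρ I where
  -- Passing to elements lying `≫` above the ultrafilter makes the filter round; `b` is kept bounded
  -- because interpolation needs a bounded left side.
  carrier := {a | ∃ b ∈ I, b ∉ J ∧ NonTang ρ b a}
  bot_notMem' := by
    rintro ⟨b, -, hbJ, hb⟩
    have hb' := le_bot_iff.1 (h.le_of_nonTang hb)
    exact hbJ (hb' ▸ J.bot_mem)
  mem_of_le' := by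
    rintro a b hab ⟨c, hcI, hcJ, hc⟩
    exact ⟨c, hcI, hcJ, h.nonTang_mono le_rfl hab hc⟩
  inf_mem' := by
    rintro a ⟨c, hcI, hcJ, hc⟩ b ⟨c', -, hcJ', hc'⟩
    exact ⟨c ⊓ c', I.lower inf_le_left hcI, fun hm => (hJ.mem_or_mem hm).elim hcJ hcJ',
      h.nonTang_inf hc hc'⟩
  round' := by
    rintro a ⟨b, hbI, hbJ, hb⟩
    obtain ⟨c, -, hbc, hca⟩ := h.interpolate b hbI a hb
    exact ⟨c, ⟨b, hbI, hbJ, hbc⟩, hca⟩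
  compl_mem_or_mem' := by
    intro a b hab
    obtain ⟨d', hdI', hdd', -⟩ := h.interpolate d hdI ⊤ (h.nonTang_top d)
    -- `a` may be unbounded, so it is cut down by a bounded `d' ≫ d`. If `eᶜ` is in the ultrafilter,
    -- then `eᶜ ⊓ d ≪ (a ⊓ d')ᶜ ⊓ d' ≤ aᶜ`.
    obtain ⟨e, -, hae, heb⟩ := h.interpolate (a ⊓ d') (I.lower inf_le_right hdI') b
      (h.nonTang_mono inf_le_left le_rfl hab)
    rcases hJ.mem_or_mem (x := e) (y := eᶜ) (by simp) with he | he
    · left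
      have he' : eᶜ ∉ J := fun he' => hJ.toIsProper.notMem_of_compl_mem he' he
      refine ⟨eᶜ ⊓ d, I.lower inf_le_right hdI, fun hm => (hJ.mem_or_mem hm).elim he' hdJ, ?_⟩
      refine h.nonTang_mono le_rfl ?_ (h.nonTang_inf (h.nonTang_compl hae) hdd')
      rw [compl_inf, inf_sup_right, compl_inf_eq_bot, sup_bot_eq]
      exact inf_le_left
    · right
      have he' : e ∉ J := hJ.toIsProper.notMem_of_compl_mem he
      exact ⟨e ⊓ d, I.lower inf_le_right hdI, fun hm => (hJ.mem_or_mem hm).elim he' hdJ,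
        h.nonTang_mono inf_le_left le_rfl heb⟩
  exists_bounded' := by
    obtain ⟨d', hdI', hdd', -⟩ := h.interpolate d hdI ⊤ (h.nonTang_top d)
    exact ⟨d', hdI', d, hdI, hdJ, hdd'⟩

theorem exists_isPrime_of_notMem {J : Order.Ideal B} (hb : b ∉ J) :
    ∃ J' : Order.Ideal B, J'.IsPrime ∧ J ≤ J' ∧ b ∉ J' := by
  obtain ⟨J', hJ', hle, hd⟩ := DistribLattice.prime_ideal_of_disjoint_filter_ideal
    (F := Order.PFilter.principal b) (I := J)
    (Set.disjoint_left.2 fun c hc hcJ => hb (J.lower (Order.PFilter.mem_principal.1 hc) hcJ))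
  exact ⟨J', hJ', hle, Set.disjoint_left.1 hd (Order.PFilter.mem_principal.2 le_rfl)⟩

/-- If `b` is bounded and outside the ideal `J`, there is a point whose filter consists of elements
outside `J` and does not contain the complement of `b`. -/
theorem exists_point (h : IsLocalContact ρ I) (hb : b ∈ I) {J : Order.Ideal B} (hbJ : b ∉ J) :
    ∃ p : RoundPoint ρ I, bᶜ ∉ p ∧ ∀ a ∈ p, ∃ d ∉ J, NonTang ρ d a := by
  obtain ⟨J', hJ', hle, hbJ'⟩ := exists_isPrime_of_notMem hbJ
  refine ⟨ofPrime h J' hJ' b hb hbJ', ?_, ?_⟩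
  · rintro ⟨d, -, hdJ, hd⟩
    have hdb : d ⊓ b = ⊥ := disjoint_iff.1 (le_compl_iff_disjoint_right.1 (h.le_of_nonTang hd))
    exact (hJ'.mem_or_mem (hdb ▸ J'.bot_mem)).elim hdJ hbJ'
  · rintro a ⟨d, -, hdJ, hd⟩
    exact ⟨d, fun hm => hdJ (hle hm), hd⟩

theorem exists_mem (h : IsLocalContact ρ I) (ha : a ≠ ⊥) : ∃ p : RoundPoint ρ I, a ∈ p := by
  obtain ⟨b, hb, hb0, hba⟩ := h.exists_bounded a ha
  obtain ⟨p, hp, -⟩ := exists_point h hb (J := .principal ⊥)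
    fun hm => hb0 (le_bot_iff.1 hm)
  exact ⟨p, (p.compl_mem_or_mem hba).resolve_left hp⟩

/-- The elements out of contact with `a` form an ideal that misses `c ⊓ b` for a suitable bounded
`c`. A point built outside this ideal cannot contain `aᶜ`, since that would need some `d ≪ aᶜ` in
contact with `a`. -/
theorem exists_of_rel (h : IsLocalContact ρ I) (hab : ρ a b) :
    ∃ p : RoundPoint ρ I, aᶜ ∉ p ∧ bᶜ ∉ p := by
  obtain ⟨c, hc, hac⟩ := h.rel_bounded a b hab
  let J : Order.Ideal B :=
    { carrier := {d | ¬ ρ a d}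
      lower' := fun d e hed hd he => hd (h.mono le_rfl hed he)
      nonempty' := ⟨⊥, fun h' => (h.ne_bot _ _ h').2 rfl⟩
      directed' := fun d hd e he => ⟨d ⊔ e,
        fun h' => ((h.sup_right _ _ _).1 h').elim hd he, le_sup_left, le_sup_right⟩ }
  obtain ⟨p, hp, hpJ⟩ := exists_point h (I.lower inf_le_left hc) (J := J) (not_not_intro hac)
  refine ⟨p, fun ha => ?_, fun hb => hp (mem_of_le (compl_le_compl inf_le_right) hb)⟩
  obtain ⟨d, hd, hda⟩ := hpJ _ ha
  rw [NonTang, compl_compl] at hda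
  exact hda (h.symm _ _ (not_not.1 hd))

/-! ### The topology on the space of points -/

/-- The basic open set of points containing `a`. -/
def basicOpen (ρ : B → B → Prop) (I : Order.Ideal B) (a : B) : Set (RoundPoint ρ I) := {p | a ∈ p}

@[simp] theorem mem_basicOpen : p ∈ basicOpen ρ I a ↔ a ∈ p := Iff.rfl

instance : TopologicalSpace (RoundPoint ρ I) :=
  TopologicalSpace.generateFrom (Set.range (basicOpen ρ I))

theorem isTopologicalBasis_basicOpen :
    TopologicalSpace.IsTopologicalBasis (Set.range (basicOpen ρ I)) where
  exists_subset_inter := by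
    rintro _ ⟨a, rfl⟩ _ ⟨b, rfl⟩ p ⟨ha, hb⟩
    exact ⟨_, ⟨a ⊓ b, rfl⟩, inf_mem_iff.2 ⟨ha, hb⟩, fun q hq => inf_mem_iff.1 hq⟩
  sUnion_eq := Set.eq_univ_of_forall fun p => ⟨_, ⟨⊤, rfl⟩, p.top_mem⟩
  eq_generateFrom := rfl

theorem isOpen_basicOpen (a : B) : IsOpen (basicOpen ρ I a) :=
  isTopologicalBasis_basicOpen.isOpen ⟨a, rfl⟩

theorem mem_closure_basicOpen_iff (h : IsLocalContact ρ I) :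
    p ∈ closure (basicOpen ρ I a) ↔ aᶜ ∉ p := by
  rw [isTopologicalBasis_basicOpen.mem_closure_iff]
  constructor
  · intro hp ha
    obtain ⟨q, hq, hqa⟩ := hp _ ⟨aᶜ, rfl⟩ ha
    exact compl_notMem hqa hq
  · rintro hp _ ⟨c, rfl⟩ hc
    -- If `c ⊓ a` were zero, then `c ≤ aᶜ` would put `aᶜ` in `p`.
    obtain ⟨q, hq⟩ := exists_mem h (a := c ⊓ a) fun h0 =>
      hp (mem_of_le (le_compl_iff_disjoint_right.2 (disjoint_iff.2 h0)) hc)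
    exact ⟨q, inf_mem_iff.1 hq⟩

theorem closure_basicOpen (h : IsLocalContact ρ I) (a : B) :
    closure (basicOpen ρ I a) = (basicOpen ρ I aᶜ)ᶜ :=
  Set.ext fun _ => mem_closure_basicOpen_iff h

theorem t2Space : T2Space (RoundPoint ρ I) := by
  have key : ∀ p q : RoundPoint ρ I, ∀ a ∈ p, a ∉ q →
      ∃ u v : Set (RoundPoint ρ I), IsOpen u ∧ IsOpen v ∧ p ∈ u ∧ q ∈ v ∧ Disjoint u v := by
    intro p q a hp hq
    -- Roundness gives `b ≪ a` in `p`; as `a ∉ q`, the point `q` must contain `bᶜ`.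
    obtain ⟨b, hb, hba⟩ := exists_nonTang hp
    exact ⟨_, _, isOpen_basicOpen b, isOpen_basicOpen bᶜ, hb,
      (q.compl_mem_or_mem hba).resolve_right hq, Set.disjoint_left.2 fun _ => compl_notMem⟩
  refine ⟨fun p q hne => ?_⟩
  by_cases hpq : ∀ a ∈ p, a ∈ q
  · obtain ⟨a, hq, hp⟩ : ∃ a ∈ q, a ∉ p := by
      by_contra! hqp
      exact hne (SetLike.ext fun a => ⟨hpq a, hqp a⟩)
    obtain ⟨u, v, hu, hv, hpu, hqv, huv⟩ := key q p a hq hp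
    exact ⟨v, u, hv, hu, hqv, hpu, huv.symm⟩
  · push Not at hpq
    obtain ⟨a, hp, hq⟩ := hpq
    exact key p q a hp hq

theorem isCompact_closure_basicOpen (h : IsLocalContact ρ I) (ha : a ∈ I) :
    IsCompact (closure (basicOpen ρ I a)) := by
  -- By Alexander's subbase theorem, covers by basic open sets suffice. The elements whose basic
  -- closure is finitely covered form an ideal `J`, and the claim is `a ∈ J`.
  refine isCompact_generateFrom rfl fun P hP hcov => ?_
  let J : Order.Ideal B :=
    { carrier := {d | ∃ Q ⊆ P, Q.Finite ∧ closure (basicOpen ρ I d) ⊆ ⋃₀ Q}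
      lower' := by
        rintro d e hed ⟨Q, hQP, hQ, hd⟩
        exact ⟨Q, hQP, hQ,
          Set.Subset.trans (closure_mono (s := basicOpen ρ I e) (t := basicOpen ρ I d)
            fun p hp => mem_of_le hed hp) hd⟩
      nonempty' := ⟨⊥, ∅, Set.empty_subset _, Set.finite_empty, fun p hp =>
        absurd (show (⊥ : B)ᶜ ∈ p by simpa using p.top_mem) ((mem_closure_basicOpen_iff h).1 hp)⟩
      directed' := by
        rintro d ⟨Q, hQP, hQ, hd⟩ e ⟨Q', hQP', hQ', he⟩
        refine ⟨d ⊔ e, ⟨Q ∪ Q', Set.union_subset hQP hQP', hQ.union hQ', fun p hp => ?_⟩,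
          le_sup_left, le_sup_right⟩
        rw [mem_closure_basicOpen_iff h, compl_sup, inf_mem_iff, not_and_or,
          ← mem_closure_basicOpen_iff h, ← mem_closure_basicOpen_iff h] at hp
        rw [Set.sUnion_union]
        exact hp.imp (@hd p) (@he p) }
  by_contra hJ
  obtain ⟨p, hp, hpJ⟩ := exists_point h ha (J := J) hJ
  obtain ⟨U, hU, hpU⟩ := hcov ((mem_closure_basicOpen_iff h).2 hp)
  obtain ⟨c, rfl⟩ := hP hU
  obtain ⟨d, hd, hdc⟩ := hpJ c hpU
  -- Since `d ≪ c`, the closure of `basicOpen ρ I d` lies in the single member `basicOpen ρ I c`,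
  -- contradicting `d ∉ J`.
  refine hd ⟨{basicOpen ρ I c}, Set.singleton_subset_iff.2 hU, Set.finite_singleton _, fun q hq => ?_⟩
  rw [Set.sUnion_singleton]
  exact (q.compl_mem_or_mem hdc).resolve_left ((mem_closure_basicOpen_iff h).1 hq)

theorem locallyCompactSpace (h : IsLocalContact ρ I) : LocallyCompactSpace (RoundPoint ρ I) := by
  have := t2Space (ρ := ρ) (I := I)
  have : WeaklyLocallyCompactSpace (RoundPoint ρ I) := ⟨fun p =>
    let ⟨a, haI, ha⟩ := p.exists_bounded
    ⟨_, isCompact_closure_basicOpen h haI,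
      Filter.mem_of_superset ((isOpen_basicOpen a).mem_nhds ha) subset_closure⟩⟩
  infer_instance

theorem le_of_basicOpen_subset (h : IsLocalContact ρ I)
    (hab : basicOpen ρ I a ⊆ basicOpen ρ I b) : a ≤ b := by
  by_contra hle
  rw [← disjoint_compl_right_iff, disjoint_iff] at hle
  obtain ⟨p, hp⟩ := exists_mem h hle
  rw [inf_mem_iff] at hp
  exact compl_notMem (hab hp.1) hp.2

/-- Every point contains a bounded element, so by compactness `a` lies below a finite join of
bounded elements. -/
theorem mem_ideal_of_isCompact (h : IsLocalContact ρ I)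
    (ha : IsCompact (closure (basicOpen ρ I a))) : a ∈ I := by
  obtain ⟨t, ht⟩ := ha.elim_finite_subcover (fun c : I => basicOpen ρ I (c : B))
    (fun c => isOpen_basicOpen _) fun p _ =>
      let ⟨c, hcI, hc⟩ := p.exists_bounded
      Set.mem_iUnion.2 ⟨⟨c, hcI⟩, hc⟩
  refine I.lower (le_of_basicOpen_subset (b := t.sup fun c => (c : B)) h fun p hp => ?_)
    ((Order.Ideal.finsetSup_mem_iff I).2 fun c _ => c.2)
  obtain ⟨c, hc, hpc⟩ := Set.mem_iUnion₂.1 (ht (subset_closure hp))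
  exact mem_of_le (Finset.le_sup (f := fun c : I => (c : B)) hc) hpc

/-- The basic open sets are regular open. -/
def toRegularOpen (h : IsLocalContact ρ I) (a : B) : RegularOpen (RoundPoint ρ I) where
  carrier := basicOpen ρ I a
  interior_closure' := by
    rw [closure_basicOpen h, interior_compl, closure_basicOpen h, compl_compl, compl_compl]

@[simp] theorem coe_toRegularOpen (h : IsLocalContact ρ I) (a : B) :
    (toRegularOpen h a : Set (RoundPoint ρ I)) = basicOpen ρ I a := rfl

theorem contact_toRegularOpen_iff (h : IsLocalContact ρ I) :
    RegularOpen.Contact (toRegularOpen h a) (toRegularOpen h b) ↔ ρ a b := by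
  constructor
  · rintro ⟨p, ha, hb⟩
    rw [coe_toRegularOpen, mem_closure_basicOpen_iff h] at ha hb
    by_contra hab
    exact (p.compl_mem_or_mem (a := a) (b := bᶜ) (by rwa [NonTang, compl_compl])).elim ha hb
  · intro hab
    obtain ⟨p, ha, hb⟩ := exists_of_rel h hab
    exact ⟨p, (mem_closure_basicOpen_iff h).2 ha, (mem_closure_basicOpen_iff h).2 hb⟩

theorem toRegularOpen_mem_compactClosure_iff (h : IsLocalContact ρ I) :
    toRegularOpen h a ∈ RegularOpen.compactClosure _ ↔ a ∈ I :=
  ⟨mem_ideal_of_isCompact h, isCompact_closure_basicOpen h⟩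

end BooleanAlgebra

section CompleteBooleanAlgebra

variable {B : Type*} [CompleteBooleanAlgebra B] {ρ : B → B → Prop} {I : Order.Ideal B}

theorem toRegularOpen_surjective (h : IsLocalContact ρ I) :
    Function.Surjective (toRegularOpen h) := by
  intro U
  let S : Set B := {a | basicOpen ρ I a ⊆ U}
  -- Completeness enters here. A basic set missing `U` comes from an element disjoint from all of
  -- `S`, hence from `sSup S`; so `sSup S` adds only points of `cl U`.
  refine ⟨sSup S, SetLike.coe_injective (subset_antisymm ?_ ?_)⟩
  · have hcl : basicOpen ρ I (sSup S) ⊆ closure U := by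
      intro p hp
      rw [isTopologicalBasis_basicOpen.mem_closure_iff]
      rintro _ ⟨c, rfl⟩ hc
      by_contra hemp
      have hdisj : sSup S ≤ cᶜ := by
        refine sSup_le fun a ha => le_compl_iff_disjoint_right.2 (disjoint_iff.2 ?_)
        by_contra hne
        obtain ⟨q, hq⟩ := exists_mem h hne
        rw [inf_mem_iff] at hq
        exact hemp ⟨q, hq.2, ha hq.1⟩
      exact compl_notMem hc (mem_of_le hdisj hp)
    rw [coe_toRegularOpen, ← U.interior_closure]
    exact interior_maximal hcl (isOpen_basicOpen _)
  · intro p hp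
    obtain ⟨_, ⟨a, rfl⟩, hpa, ha⟩ :=
      isTopologicalBasis_basicOpen.exists_subset_of_mem_open hp U.isOpen
    exact mem_of_le (le_sSup (show a ∈ S from ha)) hpa

/-- A complete local contact algebra is isomorphic to the regular open algebra of its space of
points. -/
noncomputable def regularOpenIso (h : IsLocalContact ρ I) :
    B ≃o RegularOpen (RoundPoint ρ I) :=
  RelIso.ofSurjective
    (OrderEmbedding.ofMapLEIff (toRegularOpen h) fun _ _ =>
      ⟨le_of_basicOpen_subset h, fun hab _ hp => mem_of_le hab hp⟩)
    (toRegularOpen_surjective h)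

end CompleteBooleanAlgebra

end RoundPoint

/-! ### Normal contact algebras as local contact algebras -/

theorem IsLocalContact.isNormalContact {B : Type*} [BooleanAlgebra B] {ρ : B → B → Prop}
    {I : Order.Ideal B} (h : IsLocalContact ρ I) (hI : ∀ a, a ∈ I) : IsNormalContact ρ where
  toIsContactRel := h.toIsContactRel
  normal a b hab := by
    obtain ⟨c, -, hac, hcb⟩ := h.interpolate a (hI a) bᶜ (by rwa [NonTang, compl_compl])
    rw [NonTang, compl_compl] at hcb
    exact ⟨cᶜ, hac, fun hbc => hcb (h.symm _ _ (by rwa [compl_compl] at hbc))⟩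
  exists_not_rel a ha := by
    obtain ⟨b, -, hb, hba⟩ := h.exists_bounded aᶜ (by simpa using ha)
    exact ⟨b, hb, by rwa [NonTang, compl_compl] at hba⟩

theorem IsNormalContact.isLocalContact {B : Type*} [BooleanAlgebra B] {ρ : B → B → Prop}
    (h : IsNormalContact ρ) : IsLocalContact ρ (⊤ : Order.Ideal B) where
  toIsContactRel := h.toIsContactRel
  interpolate a _ c hac := by
    obtain ⟨b, hab, hcb⟩ := h.normal a cᶜ hac
    refine ⟨bᶜ, trivial, ?_, fun hbc => hcb (h.symm _ _ hbc)⟩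
    rwa [NonTang, compl_compl]
  rel_bounded a b hab := ⟨⊤, trivial, by rwa [top_inf_eq]⟩
  exists_bounded a ha := by
    obtain ⟨b, hb, hba⟩ := h.exists_not_rel aᶜ (by simpa using ha)
    exact ⟨b, trivial, hb, hba⟩

theorem RegularOpen.mem_compactClosure_of_compactSpace {X : Type*} [TopologicalSpace X]
    [CompactSpace X] (U : RegularOpen X) : U ∈ compactClosure X :=
  isClosed_closure.isCompact

theorem RoundPoint.compactSpace {B : Type*} [BooleanAlgebra B] {ρ : B → B → Prop}
    (h : IsLocalContact ρ (⊤ : Order.Ideal B)) :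
    CompactSpace (RoundPoint ρ (⊤ : Order.Ideal B)) := by
  have hc := isCompact_closure_basicOpen h (a := ⊤) trivial
  have htop : basicOpen ρ (⊤ : Order.Ideal B) ⊤ = Set.univ :=
    Set.eq_univ_of_forall fun p => p.top_mem
  rw [htop, closure_univ] at hc
  exact ⟨hc⟩

theorem leftAdj_orderIso {A B : Type*} [CompleteBooleanAlgebra A] [CompleteBooleanAlgebra B]
    (e : A ≃o B) (b : B) : leftAdj (e : CompleteLatticeHom A B) b = e.symm b :=
  (gc_leftAdj (e : CompleteLatticeHom A B)).l_unique e.symm.to_galoisConnection fun _ => rfl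

/-! ### The duality for locally compact spaces -/

namespace DSkePerLC

/-- An order isomorphism that preserves and reflects contact and boundedness is an isomorphism of
local contact algebras. -/
def isoMk {A B : DSkePerLC.{u}} (e : A.carrier ≃o B.carrier)
    (hrel : ∀ a b, B.rel (e a) (e b) ↔ A.rel a b) (hb : ∀ a, e a ∈ B.bounded ↔ a ∈ A.bounded) :
    A ≅ B where
  hom :=
    { toHom := (e : CompleteLatticeHom A.carrier B.carrier)
      rel_of_map := fun a b => (hrel a b).1
      leftAdj_bounded := fun b h => by
        rwa [leftAdj_orderIso, ← hb, OrderIso.apply_symm_apply]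
      map_bounded := fun a => (hb a).2 }
  inv :=
    { toHom := (e.symm : CompleteLatticeHom B.carrier A.carrier)
      rel_of_map := fun a b h => by
        have := (hrel (e.symm a) (e.symm b)).2 h
        rwa [e.apply_symm_apply, e.apply_symm_apply] at this
      leftAdj_bounded := fun a h => by
        rw [leftAdj_orderIso]
        exact (hb a).2 h
      map_bounded := fun b h => (hb _).1 (by
        change e (e.symm b) ∈ _
        rwa [e.apply_symm_apply]) }
  hom_inv_id := Hom.ext (by ext a; exact e.symm_apply_apply a)
  inv_hom_id := Hom.ext (by ext a; exact e.apply_symm_apply a)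

instance : isConnected.{u}.IsClosedUnderIsomorphisms where
  of_iso {A B} i hA b hb hb' := by
    have hinv : ∀ x : B.carrier, i.hom.toHom (i.inv.toHom x) = x := fun x =>
      congrArg (fun f : B ⟶ B => f.toHom x) i.inv_hom_id
    -- The inverse reflects contact, so it suffices that the image of `b` in `A` touches its
    -- complement.
    refine i.inv.rel_of_map _ _ ?_
    rw [map_compl']
    refine hA _ (fun h => hb ?_) (fun h => hb' ?_)
    · rw [← hinv b, h, map_bot]
    · rw [← hinv b, h, map_top]

end DSkePerLC

namespace SkePerLC

/-- The contravariant functor sending a locally compact Hausdorff space to its algebra of regular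
open sets. -/
def regularOpenFunctor : SkePerLC.{u}ᵒᵖ ⥤ DSkePerLC.{u} where
  obj X :=
    { carrier := RegularOpen X.unop.carrier
      rel := RegularOpen.Contact
      bounded := RegularOpen.compactClosure _
      isLocalContact := RegularOpen.isLocalContact_contact }
  map f :=
    { toHom := f.unop.isQuasiOpenMap.comap
      rel_of_map := fun _ _ => f.unop.isQuasiOpenMap.contact_of_comap
      leftAdj_bounded := fun _ => f.unop.isQuasiOpenMap.leftAdj_mem_compactClosure
      map_bounded := fun _ => f.unop.isQuasiOpenMap.comap_mem_compactClosure f.unop.isPerfectMap }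
  map_id _ := DSkePerLC.Hom.ext IsQuasiOpenMap.comap_id
  map_comp f g := DSkePerLC.Hom.ext
    (f.unop.isQuasiOpenMap.comap_comp g.unop.isQuasiOpenMap)

instance : regularOpenFunctor.{u}.Faithful where
  map_injective {_ _ f g} h := Quiver.Hom.unop_inj <| Hom.ext <|
    f.unop.isQuasiOpenMap.eq_of_comap_eq g.unop.isQuasiOpenMap (congrArg DSkePerLC.Hom.toHom h)

instance : regularOpenFunctor.{u}.Full where
  map_surjective {X Y} φ := by
    obtain ⟨f, hq, hp, hf⟩ := exists_quasiOpen_perfect_comap_eq (X := Y.unop.carrier)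
      (Y := X.unop.carrier) φ.toHom φ.rel_of_map φ.leftAdj_bounded φ.map_bounded
    exact ⟨Quiver.Hom.op (⟨f, hq, hp⟩ : Y.unop ⟶ X.unop), DSkePerLC.Hom.ext hf⟩

instance : regularOpenFunctor.{u}.EssSurj where
  mem_essImage B := by
    have := RoundPoint.t2Space (ρ := B.rel) (I := B.bounded)
    have := RoundPoint.locallyCompactSpace B.isLocalContact
    refine ⟨.op ⟨RoundPoint B.rel B.bounded⟩, ⟨Iso.symm (DSkePerLC.isoMk
      (RoundPoint.regularOpenIso B.isLocalContact) (fun a b => ?_) (fun a => ?_))⟩⟩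
    · exact RoundPoint.contact_toRegularOpen_iff B.isLocalContact
    · exact RoundPoint.toRegularOpen_mem_compactClosure_iff B.isLocalContact

instance : regularOpenFunctor.{u}.IsEquivalence where

end SkePerLC

/-! ### The duality for compact spaces -/

namespace DSkeC

/-- An order isomorphism that preserves and reflects contact is an isomorphism of normal contact
algebras. -/
def isoMk {A B : DSkeC.{u}} (e : A.carrier ≃o B.carrier)
    (hrel : ∀ a b, B.rel (e a) (e b) ↔ A.rel a b) : A ≅ B where
  hom :=
    { toHom := (e : CompleteLatticeHom A.carrier B.carrier)
      rel_of_map := fun a b => (hrel a b).1 }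
  inv :=
    { toHom := (e.symm : CompleteLatticeHom B.carrier A.carrier)
      rel_of_map := fun a b h => by
        have := (hrel (e.symm a) (e.symm b)).2 h
        rwa [e.apply_symm_apply, e.apply_symm_apply] at this }
  hom_inv_id := Hom.ext (by ext a; exact e.symm_apply_apply a)
  inv_hom_id := Hom.ext (by ext a; exact e.apply_symm_apply a)

instance : isConnected.{u}.IsClosedUnderIsomorphisms where
  of_iso {A B} i hA b hb hb' := by
    have hinv : ∀ x : B.carrier, i.hom.toHom (i.inv.toHom x) = x := fun x =>
      congrArg (fun f : B ⟶ B => f.toHom x) i.inv_hom_id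
    refine i.inv.rel_of_map _ _ ?_
    rw [map_compl']
    refine hA _ (fun h => hb ?_) (fun h => hb' ?_)
    · rw [← hinv b, h, map_bot]
    · rw [← hinv b, h, map_top]

end DSkeC

namespace SkeC

/-- The contravariant functor sending a compact Hausdorff space to its algebra of regular open
sets. -/
def regularOpenFunctor : SkeC.{u}ᵒᵖ ⥤ DSkeC.{u} where
  obj X :=
    { carrier := RegularOpen X.unop.carrier
      rel := RegularOpen.Contact
      isNormalContact := RegularOpen.isLocalContact_contact.isNormalContact
        RegularOpen.mem_compactClosure_of_compactSpace }
  map f :=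
    { toHom := f.unop.isQuasiOpenMap.comap
      rel_of_map := fun _ _ => f.unop.isQuasiOpenMap.contact_of_comap }
  map_id _ := DSkeC.Hom.ext IsQuasiOpenMap.comap_id
  map_comp f g := DSkeC.Hom.ext (f.unop.isQuasiOpenMap.comap_comp g.unop.isQuasiOpenMap)

instance : regularOpenFunctor.{u}.Faithful where
  map_injective {_ _ f g} h := Quiver.Hom.unop_inj <| Hom.ext <|
    f.unop.isQuasiOpenMap.eq_of_comap_eq g.unop.isQuasiOpenMap (congrArg DSkeC.Hom.toHom h)

instance : regularOpenFunctor.{u}.Full where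
  map_surjective {X Y} φ := by
    -- Over compact spaces every regular open set is bounded, so both boundedness conditions hold
    -- automatically.
    obtain ⟨f, hq, -, hf⟩ := exists_quasiOpen_perfect_comap_eq (X := Y.unop.carrier)
      (Y := X.unop.carrier) φ.toHom φ.rel_of_map
      (fun _ _ => RegularOpen.mem_compactClosure_of_compactSpace _)
      (fun _ _ => RegularOpen.mem_compactClosure_of_compactSpace _)
    exact ⟨Quiver.Hom.op (⟨f, hq⟩ : Y.unop ⟶ X.unop), DSkeC.Hom.ext hf⟩

instance : regularOpenFunctor.{u}.EssSurj where
  mem_essImage B := by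
    have h := B.isNormalContact.isLocalContact
    have := RoundPoint.t2Space (ρ := B.rel) (I := ⊤)
    have := RoundPoint.compactSpace h
    refine ⟨.op ⟨RoundPoint B.rel ⊤⟩, ⟨Iso.symm (DSkeC.isoMk
      (RoundPoint.regularOpenIso h) (fun a b => ?_))⟩⟩
    exact RoundPoint.contact_toRegularOpen_iff h

instance : regularOpenFunctor.{u}.IsEquivalence where

end SkeC

/-! ### Restriction to connected objects -/

/-- A contravariant equivalence that matches two properties of objects restricts to a dual
equivalence of full subcategories. -/
theorem duallyEquivalent_fullSubcategory {C D : Type*} [Category C] [Category D] (F : Cᵒᵖ ⥤ D)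
    [F.IsEquivalence] (P : ObjectProperty C) (Q : ObjectProperty D)
    [Q.IsClosedUnderIsomorphisms] (h : ∀ X, Q (F.obj (.op X)) ↔ P X) :
    DuallyEquivalent P.FullSubcategory Q.FullSubcategory := by
  let G : P.FullSubcategoryᵒᵖ ⥤ Q.FullSubcategory :=
    Q.lift (P.ι.op ⋙ F) fun X => (h _).2 X.unop.property
  have : G.EssSurj := ⟨fun Y => by
    let e := F.objObjPreimageIso Y.obj
    -- Essential surjectivity is the only point to check by hand: the preimage object has `P`
    -- because `Q` is invariant under isomorphism.
    have hP : P (F.objPreimage Y.obj).unop := (h _).1 (Q.prop_of_iso e.symm Y.property)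
    exact ⟨.op ⟨_, hP⟩, ⟨Q.isoMk e⟩⟩⟩
  have : G.IsEquivalence := { }
  exact ⟨G.asEquivalence⟩

end ContactDuality

theorem theorem3p2 :
    ContactDuality.DuallyEquivalent ContactDuality.SkePerLCCon.{u}
        ContactDuality.DSkePerLCCon.{u} ∧
      ContactDuality.DuallyEquivalent ContactDuality.SkeCCon.{u} ContactDuality.DSkeCCon.{u} :=
  ⟨ContactDuality.duallyEquivalent_fullSubcategory ContactDuality.SkePerLC.regularOpenFunctor _ _
      fun _ => ContactDuality.RegularOpen.isConnectedRel_contact_iff,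
    ContactDuality.duallyEquivalent_fullSubcategory ContactDuality.SkeC.regularOpenFunctor _ _
      fun _ => ContactDuality.RegularOpen.isConnectedRel_contact_iff⟩
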